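/- Let $\mathbb{F}_q$ be a finite field with $q$ elements, let $K=\mathbb{F}_q(T)$ with algebraic closure $\overline{K}$, and let $K_\infty=(\mathbb{F}_q(T))_\infty$ be the completion of $K$ at the infinite place $\mathfrak{p}_\infty$ (the place of the valuation $-\deg$). For $M=\sum_{i=0}^n a_iT^i\in\mathbb{F}_q[T]$ and $u\in\overline{K}$, let $$u_q^M=\sum_{i=0}^n a_i\,(\phi_q+\mu_T)^i(u),\qquad \phi_q(u)=u^q,\quad \mu_T(u)=Tu,$$ be the Carlitz action. Let $\Lambda_{q,M}=\{u\in\overline{K} : u_q^M=0\}$, and let $\mathbb{T}_q=\bigcup_{M\neq 0}\Lambda_{q,M}$ be the set of all Carlitz torsion points. Fix any place $\mathfrak{P}$ of $\overline{K}$ above $\mathfrak{p}_\infty$, let $\overline{K}_{\mathfrak{P}}$ be the completion of $\overline{K}$ at $\mathfrak{P}$, and regard $K_\infty$ as a subfield of $\overline{K}_{\mathfrak{P}}$ through the continuous extension of the inclusion $K\subset\overline{K}$. Let the $q$-unit circle $\mathbb{S}_q$ be the closure of $\mathbb{T}_q$ in $\overline{K}_{\mathfrak{P}}$ (the completion of $\mathbb{T}_q$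 at $\mathfrak{P}$). Then the field $V_q=K_\infty(\mathbb{S}_q)\subset\overline{K}_{\mathfrak{P}}$, generated over $K_\infty$ by $\mathbb{S}_q$, is a vector space over $K_\infty$ of dimension exactly $q-1$. -/

import Mathlib

open Polynomial
open scoped WithZero

noncomputable section

namespace QUnitCircle

/-- An algebraic closure of the rational function field `𝔽_q(T)`. -/
abbrev KBar (Fq : Type*) [Field Fq] : Type _ := AlgebraicClosure (RatFunc Fq)

/-! ### The Carlitz action and its torsion points -/

section Carlitz

variable (Fq : Type*) [Field Fq] [Fintype Fq]

/-- The `𝔽_q`-linear operator `φ_q + μ_T : u ↦ u ^ q + T * u`. -/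
def carlitzT : Module.End Fq (KBar Fq) :=
  (FiniteField.frobeniusAlgHom Fq (KBar Fq)).toLinearMap +
    LinearMap.mulLeft Fq (algebraMap (RatFunc Fq) (KBar Fq) RatFunc.X)

theorem carlitzT_apply (u : KBar Fq) :
    carlitzT Fq u = u ^ Fintype.card Fq + algebraMap (RatFunc Fq) (KBar Fq) RatFunc.X * u :=
  rfl

variable {Fq}

/-- The Carlitz action of `M = a_n T ^ n + ⋯ + a_0` on `u`, that is
`a_n (φ_q + μ_T) ^ n (u) + ⋯ + a_1 (φ_q + μ_T) (u) + a_0 u`. -/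
def carlitzAction (M : Fq[X]) (u : KBar Fq) : KBar Fq :=
  aeval (carlitzT Fq) M u

/-- The Carlitz `M`-torsion points `Λ_{q,M}`. -/
def carlitzTorsion (M : Fq[X]) : Set (KBar Fq) :=
  {u | carlitzAction M u = 0}

variable (Fq)

/-- The set `𝕋_q` of all Carlitz torsion points, for nonzero polynomials `M`. -/
def allCarlitzTorsion : Set (KBar Fq) :=
  ⋃ M : {M : Fq[X] // M ≠ 0}, carlitzTorsion M.1

end Carlitz

/-! ### Places above infinity and completions -/

section Places

variable (Fq : Type*) [Field Fq]

open scoped Classical in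
/-- The valuation of `𝔽_q(T)` at the infinite place, `f / g ↦ exp (deg f - deg g)`. -/
abbrev vInfty : Valuation (RatFunc Fq) ℤᵐ⁰ := RatFunc.inftyValuation Fq

/-- The completion `(𝔽_q(T))_∞` of `𝔽_q(T)` at the infinite place. -/
abbrev KInfty : Type _ := (vInfty Fq).Completion

/-- A place of the algebraic closure of `𝔽_q(T)` above the infinite place: a valuation ring which
meets `𝔽_q(T)` in the valuation ring of the infinite place. -/
structure PlaceAboveInfty where
  /-- The valuation ring of the place. -/
  valuationSubring : ValuationSubring (KBar Fq)
  comap_eq : valuationSubring.comap (algebraMap (RatFunc Fq) (KBar Fq)) =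
    (vInfty Fq).valuationSubring

namespace PlaceAboveInfty

variable {Fq}
variable (P : PlaceAboveInfty Fq)

/-- The valuation attached to a place. -/
abbrev valuation : Valuation (KBar Fq) P.valuationSubring.ValueGroup :=
  P.valuationSubring.valuation

/-- The completion of the algebraic closure of `𝔽_q(T)` at a place above infinity. -/
abbrev Completion : Type _ := P.valuation.Completion

/-- The embedding of the algebraic closure of `𝔽_q(T)` into its completion. -/
def embed (u : KBar Fq) : P.Completion :=
  ((WithVal.toVal P.valuation u : WithVal P.valuation) : P.Completion)

theorem isEquiv : (vInfty Fq).IsEquiv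
    (P.valuation.comap (algebraMap (RatFunc Fq) (KBar Fq))) := by
  rw [Valuation.isEquiv_iff_val_le_one]
  intro x
  rw [Valuation.comap_apply, ValuationSubring.valuation_le_one_iff,
    ← ValuationSubring.mem_comap, P.comap_eq, Valuation.mem_valuationSubring_iff]

/-- The value group of the infinite place is coinitial in that of a place above it. -/
theorem exists_le (y : KBar Fq) (hy : y ≠ 0) :
    ∃ a : RatFunc Fq, a ≠ 0 ∧ P.valuation (algebraMap _ _ a) ≤ P.valuation y := by
  let O := (vInfty Fq).valuationSubring
  let i : O →+* KBar Fq := (algebraMap (RatFunc Fq) (KBar Fq)).comp (algebraMap O (RatFunc Fq))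
  have halg : IsAlgebraic O y⁻¹ :=
    (IsFractionRing.isAlgebraic_iff O (RatFunc Fq) (KBar Fq)).2
      (Algebra.IsAlgebraic.isAlgebraic y⁻¹)
  obtain ⟨a, ha, hint⟩ := halg.exists_integral_multiple
  refine ⟨(a : RatFunc Fq), by simpa using ha, ?_⟩
  have hO : ∀ b : O, i b ∈ P.valuationSubring := fun b => by
    change (b : RatFunc Fq) ∈ P.valuationSubring.comap (algebraMap (RatFunc Fq) (KBar Fq))
    rw [P.comap_eq]
    exact b.2
  rw [Algebra.smul_def] at hint
  have hmem : i a * y⁻¹ ∈ P.valuationSubring := by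
    obtain ⟨p, hp, hpe⟩ := hint
    have hint' : IsIntegral P.valuationSubring (i a * y⁻¹) := by
      refine ⟨p.map (i.codRestrict P.valuationSubring.toSubring hO), hp.map _, ?_⟩
      rw [Polynomial.eval₂_map]
      exact hpe
    obtain ⟨z, hz⟩ := IsIntegrallyClosed.isIntegral_iff.1 hint'
    rw [← hz]
    exact z.2
  have h1 := (ValuationSubring.valuation_le_one_iff _ _).2 hmem
  rw [map_mul, map_inv₀] at h1
  have hy0 : P.valuation y ≠ 0 := (Valuation.ne_zero_iff _).2 hy
  rwa [mul_inv_le_iff₀ (zero_lt_iff.2 hy0), one_mul] at h1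

/-- The inclusion of `𝔽_q(T)` into its algebraic closure, between the valued fields. -/
abbrev inclusion : WithVal (vInfty Fq) →+* WithVal P.valuation :=
  WithVal.map (vInfty Fq) P.valuation (algebraMap (RatFunc Fq) (KBar Fq))

theorem continuous_inclusion : Continuous P.inclusion := by
  refine continuous_of_continuousAt_zero P.inclusion ?_
  rw [ContinuousAt, map_zero, (Valued.hasBasis_nhds_zero _ _).tendsto_iff
    (Valued.hasBasis_nhds_zero _ _)]
  intro γ _
  obtain ⟨r, s, hr, hs, hrs⟩ := Valuation.exists_div_eq_of_unit Valued.v γ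
  have hr0 : r ≠ 0 := (Valuation.pos_iff _).1 hr
  have hs0 : s ≠ 0 := (Valuation.pos_iff _).1 hs
  obtain ⟨a, ha, hle⟩ := P.exists_le (r / s).ofVal
    (by simpa using div_ne_zero hr0 hs0)
  have ha' : Valued.v.restrict (WithVal.toVal (vInfty Fq) a) ≠ 0 := by simpa using ha
  refine ⟨Units.mk0 _ ha', trivial, fun x hx => ?_⟩
  change Valued.v.restrict x < Valued.v.restrict (WithVal.toVal (vInfty Fq) a) at hx
  change Valued.v.restrict (P.inclusion x) < γ.1
  rw [← hrs, ← map_div₀, Valuation.restrict_lt_iff]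
  rw [Valuation.restrict_lt_iff] at hx
  have hx' : vInfty Fq x.ofVal < vInfty Fq a := hx
  have h2 := P.isEquiv.lt_iff_lt.1 hx'
  exact lt_of_lt_of_le h2 hle

/-- The embedding of `(𝔽_q(T))_∞` into the completion at the place `P`: the continuous extension
of the inclusion of `𝔽_q(T)` into its algebraic closure. -/
def completionHom : KInfty Fq →+* P.Completion :=
  UniformSpace.Completion.mapRingHom P.inclusion P.continuous_inclusion

theorem completionHom_coe (x : RatFunc Fq) :
    P.completionHom ((WithVal.toVal (vInfty Fq) x : WithVal (vInfty Fq)) : KInfty Fq) =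
      P.embed (algebraMap (RatFunc Fq) (KBar Fq) x) :=
  UniformSpace.Completion.mapRingHom_coe P.continuous_inclusion _

instance : Algebra (KInfty Fq) P.Completion := P.completionHom.toAlgebra

/-- There is a place of the algebraic closure above infinity. -/
theorem nonempty : Nonempty (PlaceAboveInfty Fq) := by
  let O := (vInfty Fq).valuationSubring
  let i : O →+* KBar Fq := (algebraMap (RatFunc Fq) (KBar Fq)).comp (algebraMap O (RatFunc Fq))
  obtain ⟨A, hA, hloc⟩ := IsLocalRing.exists_factor_valuationRing i
  refine ⟨⟨A, le_antisymm (fun x hx => ?_) (fun x hx => hA ⟨x, hx⟩)⟩⟩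
  rw [ValuationSubring.mem_comap] at hx
  by_contra hxO
  have hx0 : x ≠ 0 := fun h => hxO (h ▸ zero_mem _)
  have hinv : x⁻¹ ∈ O := (O.mem_or_inv_mem x).resolve_left hxO
  have hu : IsUnit (i.codRestrict A.toSubring hA ⟨x⁻¹, hinv⟩) := by
    refine IsUnit.of_mul_eq_one ⟨algebraMap _ _ x, hx⟩ (Subtype.ext ?_)
    change algebraMap (RatFunc Fq) (KBar Fq) x⁻¹ * algebraMap (RatFunc Fq) (KBar Fq) x = 1
    rw [← map_mul, inv_mul_cancel₀ hx0, map_one]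
  obtain ⟨b, hb⟩ := (hloc.map_nonunit _ hu).exists_right_inv
  have hb' : x⁻¹ * (b : RatFunc Fq) = 1 := congrArg Subtype.val hb
  apply hxO
  rw [show x = (b : RatFunc Fq) by field_simp at hb'; exact hb'.symm]
  exact b.2

end PlaceAboveInfty

end Places

/-! ### The `q`-unit circle -/

section Circle

variable {Fq : Type*} [Field Fq] [Fintype Fq] (P : PlaceAboveInfty Fq)

/-- The `q`-unit circle `𝕊_q`: the completion of `𝕋_q` at the place `P`, realised as the closure of
`𝕋_q` in the completion of the algebraic closure of `𝔽_q(T)` at `P`. -/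
def qUnitCircle : Set P.Completion :=
  closure (P.embed '' allCarlitzTorsion Fq)

/-- The field `V_q = (𝔽_q(T))_∞(𝕊_q)`. -/
def V : IntermediateField (KInfty Fq) P.Completion :=
  IntermediateField.adjoin (KInfty Fq) (qUnitCircle P)

end Circle

end QUnitCircle

end

/-!
Choose `l` algebraic over `𝔽_q(T)` with `l ^ (q - 1) = -T`. In the coordinate `w = u / l` the
Carlitz operator `u ↦ u ^ q + T * u` is `w ↦ T * (w - w ^ q)`, whose coefficients are rational
functions; all torsion points have coordinates in `KInfty`, the completion of `𝔽_q(T)`. This is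
shown by approximation. A torsion point satisfies `|w| ≤ 1`, for otherwise the iterates of the
operator grow (`valuation_le_of_mem_allCarlitzTorsion`). Moreover, the image `w' = T * (w - w ^ q)`
is again the coordinate of a torsion point, so if all torsion points are within `|T| ^ (-n)` of a
rational function, then `w - w ^ q = T⁻¹ * w'` is known up to `|T| ^ (-n - 1)`. The Artin–Schreier
map `w ↦ w - w ^ q` is inverted on small elements by the series
`x + x ^ q + x ^ q ^ 2 + ⋯` (`exists_sub_pow_card_eq`) and its kernel consists of the constants
(`exists_valuation_sub_algebraMap_le`), so `w` is within `|T| ^ (-n - 1)` of a rational function as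
well (`exists_valuation_sub_le_of_torsion`).

Since `KInfty` is complete, its image is closed (`isClosed_range_completionHom`), so the whole
`q`-unit circle is contained in `l * KInfty`. As `l` is itself a `T`-torsion point,
`V = KInfty(l)` (`V_eq_adjoin`). The element `l` is a root of `x ^ (q - 1) + T`, and it has no
smaller degree over `KInfty`, because its valuation has order `q - 1` modulo the value group of
`KInfty` (`card_sub_one_le_natDegree`).
-/

noncomputable section

namespace QUnitCircle

/-! ### Closures in valued fields, and the Artin–Schreier map over a finite field -/

/-- Closure points in a valued field are detected by balls whose radii are values of `v`. -/
theorem mem_closure_iff_valued {F Γ₀ : Type*} [Field F] [LinearOrderedCommGroupWithZero Γ₀]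
    [Valued F Γ₀] {s : Set F} {x : F} :
    x ∈ closure s ↔ ∀ y : F, y ≠ 0 → ∃ z ∈ s, Valued.v (z - x) < Valued.v y := by
  rw [mem_closure_iff_nhds]
  constructor
  · intro h y hy
    have hy' : Valued.v.restrict y ≠ 0 := by simpa using hy
    obtain ⟨z, hz, hzs⟩ := h {z | Valued.v.restrict (z - x) < Valued.v.restrict y}
      (Valued.mem_nhds.2 ⟨Units.mk0 _ hy', fun _ h => h⟩)
    exact ⟨z, hzs, (Valuation.restrict_lt_iff _).1 hz⟩
  · intro h t ht
    obtain ⟨γ, hγ⟩ := Valued.mem_nhds.1 ht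
    obtain ⟨r, s, hr, hs, hrs⟩ := Valuation.exists_div_eq_of_unit Valued.v γ
    obtain ⟨z, hz, hzx⟩ := h (r / s)
      (div_ne_zero ((Valuation.pos_iff _).1 hr) ((Valuation.pos_iff _).1 hs))
    refine ⟨z, hγ ?_, hz⟩
    change Valued.v.restrict (z - x) < γ.1
    rw [← hrs, ← map_div₀]
    exact (Valuation.restrict_lt_iff _).2 hzx

theorem prod_sub_algebraMap {F L : Type*} [Field F] [Fintype F] [Field L] [Algebra F L] (y : L) :
    ∏ c : F, (y - algebraMap F L c) = y ^ Fintype.card F - y := by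
  have h1 : (1 : ℕ) < Fintype.card F := Fintype.one_lt_card
  have hmonic : (X ^ Fintype.card F - X : F[X]).Monic :=
    monic_X_pow_sub (by rw [degree_X]; exact_mod_cast h1)
  have hroots := FiniteField.roots_X_pow_card_sub_X F
  have h := prod_multiset_X_sub_C_of_monic_of_roots_card_eq hmonic (by
    rw [hroots, FiniteField.X_pow_card_sub_X_natDegree_eq F h1]; rfl)
  rw [hroots] at h
  have h2 := congrArg (aeval y) h
  change aeval y (∏ c : F, (X - C c)) = _ at h2
  simpa [map_prod] using h2

section FiniteConstants

variable {F L Γ₀ : Type*} [Field F] [Fintype F] [Field L] [Algebra F L]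
  [LinearOrderedCommGroupWithZero Γ₀] (v : Valuation L Γ₀)

theorem valuation_algebraMap_eq_one {c : F} (hc : c ≠ 0) : v (algebraMap F L c) = 1 := by
  have h : v (algebraMap F L c) ^ (Fintype.card F - 1) = 1 := by
    rw [← map_pow, ← map_pow, FiniteField.pow_card_sub_one_eq_one c hc, map_one, map_one]
  have := Fintype.one_lt_card (α := F)
  exact (pow_eq_one_iff.1 h).resolve_right (by omega)

theorem valuation_algebraMap_le_one (c : F) : v (algebraMap F L c) ≤ 1 := by
  rcases eq_or_ne c 0 with rfl | hc
  · simp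
  · exact (valuation_algebraMap_eq_one v hc).le

/-- If `y - y ^ q` is small then `y` is close to a constant, with the same bound: `y ^ q - y` is the
product of the `y - c` over the constants `c`, and all of these factors except the smallest have
valuation at least `1`, because distinct constants are at distance `1`. -/
theorem exists_valuation_sub_algebraMap_le (y : L) :
    ∃ c : F, v (y - algebraMap F L c) ≤ v (y - y ^ Fintype.card F) := by
  classical
  obtain ⟨c, -, hc⟩ := Finset.exists_min_image Finset.univ
    (fun c : F => v (y - algebraMap F L c)) Finset.univ_nonempty
  refine ⟨c, ?_⟩
  rw [Valuation.map_sub_swap v y (y ^ _), ← prod_sub_algebraMap (F := F), map_prod,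
    ← Finset.mul_prod_erase _ _ (Finset.mem_univ c)]
  refine le_mul_of_one_le_right' (Finset.one_le_prod' fun d hd => ?_)
  have hcd : v (algebraMap F L (c - d)) = 1 :=
    valuation_algebraMap_eq_one v (sub_ne_zero.2 (Finset.ne_of_mem_erase hd).symm)
  calc (1 : Γ₀) = v ((y - algebraMap F L d) - (y - algebraMap F L c)) := by
        rw [← hcd, map_sub]; congr 1; ring
    _ ≤ max (v (y - algebraMap F L d)) (v (y - algebraMap F L c)) := v.map_sub _ _
    _ ≤ v (y - algebraMap F L d) := max_le le_rfl (hc d (Finset.mem_univ d))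

/-- The equation `r - r ^ q = x` is solved, up to the error `x ^ q ^ N`, by the integral element
`x + x ^ q + ⋯ + x ^ q ^ (N - 1)`. -/
theorem exists_sub_pow_card_eq (x : L) (N : ℕ) :
    ∃ r : L, r - r ^ Fintype.card F = x - x ^ Fintype.card F ^ N ∧
      (v x ≤ 1 → v r ≤ 1) := by
  refine ⟨∑ i ∈ Finset.range N, x ^ Fintype.card F ^ i, ?_, fun hx => ?_⟩
  · have h := map_sum (FiniteField.frobeniusAlgHom F L)
      (fun i => x ^ Fintype.card F ^ i) (Finset.range N)
    simp only [FiniteField.coe_frobeniusAlgHom, ← pow_mul, ← pow_succ] at h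
    rw [h, ← Finset.sum_sub_distrib, Finset.sum_range_sub', pow_zero, pow_one]
  · exact v.map_sum_le fun i _ => by rw [map_pow]; exact pow_le_one' hx _

end FiniteConstants

/-! ### The place above infinity and the embedding of the completion at infinity -/

namespace PlaceAboveInfty

variable {Fq : Type*} [Field Fq] (P : PlaceAboveInfty Fq)

/-- The indeterminate `T`, as an element of the algebraic closure. -/
abbrev T (Fq : Type*) [Field Fq] : KBar Fq := algebraMap (RatFunc Fq) (KBar Fq) RatFunc.X

theorem one_lt_valuation_T : 1 < P.valuation (T Fq) := by
  have h : 1 < vInfty Fq RatFunc.X := by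
    rw [RatFunc.inftyValuation.X, ← WithZero.exp_zero, WithZero.exp_lt_exp]
    exact one_pos
  exact P.isEquiv.one_lt_iff_one_lt.1 h

theorem exists_valuation_algebraMap_eq {a : RatFunc Fq} (ha : a ≠ 0) :
    ∃ m : ℤ, P.valuation (algebraMap _ _ a) = P.valuation (T Fq) ^ m := by
  classical
  refine ⟨a.intDegree, ?_⟩
  have h : vInfty Fq a = vInfty Fq (RatFunc.X ^ a.intDegree) := by
    rw [RatFunc.inftyValuation.X_zpow, RatFunc.inftyValuation_apply,
      RatFunc.inftyValuation_of_nonzero _ ha]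
  have h' := P.isEquiv.eq_iff.1 h
  simpa using h'

/-- The powers of `T⁻¹` tend to `0` at every place above infinity, whose value group is not assumed
to be archimedean: the values of rational functions are powers of that of `T`, and they are
coinitial. -/
theorem exists_inv_pow_lt {y : KBar Fq} (hy : y ≠ 0) :
    ∃ n : ℕ, (P.valuation (T Fq))⁻¹ ^ n < P.valuation y := by
  obtain ⟨a, ha, hle⟩ := P.exists_le y hy
  obtain ⟨m, hm⟩ := P.exists_valuation_algebraMap_eq ha
  refine ⟨m.natAbs + 1, lt_of_lt_of_le ?_ hle⟩
  rw [hm, inv_pow, ← zpow_natCast, ← zpow_neg]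
  exact zpow_lt_zpow_right₀ P.one_lt_valuation_T (by omega)

/-- `embed` as a ring homomorphism. -/
def embedHom : KBar Fq →+* P.Completion :=
  UniformSpace.Completion.coeRingHom.comp (WithVal.equiv P.valuation).symm.toRingHom

theorem valued_embedHom (u : KBar Fq) : Valued.v (P.embedHom u) = P.valuation u :=
  Valued.valuedCompletion_apply (WithVal.toVal P.valuation u)

theorem isUniformInducing_inclusion : IsUniformInducing P.inclusion := by
  refine AddMonoidHom.isUniformInducing_of_isInducing (f := P.inclusion) ?_
  refine IsTopologicalAddGroup.isInducing_iff_nhds_zero.2 (le_antisymm ?_ ?_)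
  · have h := P.continuous_inclusion.tendsto 0
    rw [map_zero] at h
    exact h.le_comap
  · intro s hs
    obtain ⟨γ, hγ⟩ := Valued.mem_nhds_zero.1 hs
    obtain ⟨r, t, hr, ht, hrt⟩ := Valuation.exists_div_eq_of_unit Valued.v γ
    have h0 : r / t ≠ 0 :=
      div_ne_zero ((Valuation.pos_iff _).1 hr) ((Valuation.pos_iff _).1 ht)
    have h1 : Valued.v.restrict (P.inclusion (r / t)) ≠ 0 := by
      simpa only [ne_eq, Valuation.restrict_eq_zero_iff, map_eq_zero] using h0
    refine ⟨{x | Valued.v.restrict x < Valued.v.restrict (P.inclusion (r / t))},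
      Valued.mem_nhds_zero.2 ⟨Units.mk0 _ h1, fun _ h => h⟩, fun x hx => hγ ?_⟩
    change Valued.v.restrict x < γ.1
    rw [← hrt, ← map_div₀, Valuation.restrict_lt_iff]
    have hx' : Valued.v (P.inclusion x) < Valued.v (P.inclusion (r / t)) :=
      (Valuation.restrict_lt_iff _).1 hx
    exact P.isEquiv.lt_iff_lt.2 hx'

theorem isClosed_range_completionHom : IsClosed (Set.range P.completionHom) := by
  have h : IsUniformInducing P.completionHom :=
    UniformSpace.Completion.isUniformInducing_extension
      ((UniformSpace.Completion.isUniformInducing_coe _).comp P.isUniformInducing_inclusion)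
  exact h.isComplete_range.isClosed

theorem continuous_completionHom : Continuous P.completionHom :=
  UniformSpace.Completion.continuous_map

/-- On the image of `KInfty` the valuation of the completion takes only powers of the value of `T`
as nonzero values: every `a ≠ 0` is approximated by a rational function of the same valuation. -/
theorem exists_valued_completionHom_eq {a : KInfty Fq} (ha : a ≠ 0) :
    ∃ m : ℤ, Valued.v (P.completionHom a) = P.valuation (T Fq) ^ m := by
  have hmem : P.completionHom a ∈
      closure (Set.range fun k : RatFunc Fq => P.embedHom (algebraMap _ _ k)) := by
    refine map_mem_closure P.continuous_completionHom
      (UniformSpace.Completion.denseRange_coe a) ?_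
    rintro _ ⟨k, rfl⟩
    exact ⟨k.ofVal, (P.completionHom_coe k.ofVal).symm⟩
  have ha' : P.completionHom a ≠ 0 := by simpa using ha
  obtain ⟨_, ⟨k, rfl⟩, hk⟩ := mem_closure_iff_valued.1 hmem _ ha'
  have hv := Valuation.map_eq_of_sub_lt _ hk
  have hk0 : k ≠ 0 := by
    rintro rfl
    refine (Valuation.ne_zero_iff _).2 ha' (hv.symm.trans ?_)
    simp
  obtain ⟨m, hm⟩ := P.exists_valuation_algebraMap_eq hk0
  refine ⟨m, ?_⟩
  rw [← hv, valued_embedHom, hm]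

/-- An algebraic element which is a limit of rational functions at `P` lies in `KInfty`. -/
theorem embedHom_mem_range_completionHom {w : KBar Fq}
    (hw : ∀ n : ℕ, ∃ k : RatFunc Fq,
      P.valuation (w - algebraMap _ _ k) ≤ (P.valuation (T Fq))⁻¹ ^ n) :
    P.embedHom w ∈ Set.range P.completionHom := by
  have hmem : (WithVal.toVal P.valuation w) ∈ closure (Set.range P.inclusion) := by
    refine mem_closure_iff_valued.2 fun y hy => ?_
    obtain ⟨n, hn⟩ := P.exists_inv_pow_lt (y := y.ofVal) (by simpa using hy)
    obtain ⟨k, hk⟩ := hw n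
    refine ⟨_, ⟨WithVal.toVal _ k, rfl⟩, ?_⟩
    rw [Valuation.map_sub_swap]
    exact lt_of_le_of_lt hk hn
  rw [← P.isClosed_range_completionHom.closure_eq]
  change ((WithVal.toVal P.valuation w : WithVal P.valuation) : P.Completion) ∈ _
  refine map_mem_closure (UniformSpace.Completion.continuous_coe (WithVal P.valuation)) hmem ?_
  rintro _ ⟨k, rfl⟩
  exact ⟨(k : KInfty Fq), P.completionHom_coe k.ofVal⟩

end PlaceAboveInfty

/-! ### The Carlitz action in the coordinate `w = u / l`, where `l ^ (q - 1) = -T` -/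

open PlaceAboveInfty

variable {Fq : Type*} [Field Fq] [Fintype Fq] (P : PlaceAboveInfty Fq)

theorem mem_allCarlitzTorsion {u : KBar Fq} :
    u ∈ allCarlitzTorsion Fq ↔ ∃ M : Fq[X], M ≠ 0 ∧ aeval (carlitzT Fq) M u = 0 := by
  simp [allCarlitzTorsion, carlitzTorsion, carlitzAction]

theorem carlitzT_mem_allCarlitzTorsion {u : KBar Fq} (hu : u ∈ allCarlitzTorsion Fq) :
    carlitzT Fq u ∈ allCarlitzTorsion Fq := by
  obtain ⟨M, hM, h⟩ := mem_allCarlitzTorsion.1 hu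
  refine mem_allCarlitzTorsion.2 ⟨M, hM, ?_⟩
  have h2 : aeval (carlitzT Fq) (M * X) = aeval (carlitzT Fq) (X * M) := by rw [mul_comm]
  have h3 := LinearMap.congr_fun h2 u
  simpa [h] using h3

theorem exists_pow_card_sub_one_eq (Fq : Type*) [Field Fq] [Fintype Fq] :
    ∃ l : KBar Fq, l ^ (Fintype.card Fq - 1) = -T Fq := by
  have := Fintype.one_lt_card (α := Fq)
  exact IsAlgClosed.exists_pow_nat_eq _ (by omega)

theorem pow_card_eq {l : KBar Fq}
    (hl : l ^ (Fintype.card Fq - 1) = -T Fq) : l ^ Fintype.card Fq = -T Fq * l := by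
  rw [← hl, pow_sub_one_mul Fintype.card_ne_zero]

theorem ne_zero_of_pow_eq {l : KBar Fq}
    (hl : l ^ (Fintype.card Fq - 1) = -T Fq) : l ≠ 0 := by
  rintro rfl
  have := Fintype.one_lt_card (α := Fq)
  rw [zero_pow (by omega), eq_comm, neg_eq_zero] at hl
  exact RatFunc.X_ne_zero ((map_eq_zero _).1 hl)

theorem valuation_pow_eq {l : KBar Fq}
    (hl : l ^ (Fintype.card Fq - 1) = -T Fq) :
    P.valuation l ^ (Fintype.card Fq - 1) = P.valuation (T Fq) := by
  rw [← map_pow, hl, Valuation.map_neg]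

/-- In the coordinate `w = u / l` the Carlitz operator `u ↦ u ^ q + T * u` becomes `T` times the
Artin–Schreier map `w ↦ w - w ^ q`. -/
theorem carlitzT_mul {l : KBar Fq}
    (hl : l ^ (Fintype.card Fq - 1) = -T Fq) (w : KBar Fq) :
    carlitzT Fq (l * w) = l * (T Fq * (w - w ^ Fintype.card Fq)) := by
  rw [carlitzT_apply, mul_pow, pow_card_eq hl]
  ring

theorem self_mem_allCarlitzTorsion {l : KBar Fq}
    (hl : l ^ (Fintype.card Fq - 1) = -T Fq) : l ∈ allCarlitzTorsion Fq := by
  refine mem_allCarlitzTorsion.2 ⟨X, X_ne_zero, ?_⟩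
  have h := carlitzT_mul hl 1
  simpa using h

/-! ### Torsion points are limits of `l` times rational functions -/

theorem valuation_lt_valuation_carlitzT {l : KBar Fq}
    (hl : l ^ (Fintype.card Fq - 1) = -T Fq) {u : KBar Fq} (hu : P.valuation l < P.valuation u) :
    P.valuation u < P.valuation (carlitzT Fq u) := by
  have hl0 := ne_zero_of_pow_eq hl
  obtain ⟨w, rfl⟩ : ∃ w, u = l * w := ⟨u / l, by field_simp⟩
  have hv : 0 < P.valuation l := (Valuation.pos_iff _).2 hl0
  have hw : 1 < P.valuation w := by
    rw [map_mul] at hu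
    exact (lt_mul_iff_one_lt_right hv).1 hu
  have hlt : P.valuation w < P.valuation (w ^ Fintype.card Fq) := by
    rw [map_pow]
    exact lt_self_pow₀ hw Fintype.one_lt_card
  rw [carlitzT_mul hl, map_mul, map_mul, map_mul, Valuation.map_sub_eq_of_lt_right _ hlt]
  refine mul_lt_mul_of_pos_left (hlt.trans ?_) hv
  exact lt_mul_of_one_lt_left (zero_lt_one.trans (hw.trans hlt)) P.one_lt_valuation_T

/-- Torsion points are no larger than `l`: otherwise the valuations of the iterates of the Carlitz
operator increase strictly, so that the leading term dominates in `carlitzAction M u`. -/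
theorem valuation_le_of_mem_allCarlitzTorsion {l : KBar Fq}
    (hl : l ^ (Fintype.card Fq - 1) = -T Fq) {u : KBar Fq} (hu : u ∈ allCarlitzTorsion Fq) :
    P.valuation u ≤ P.valuation l := by
  classical
  by_contra! hlt
  obtain ⟨M, hM, h⟩ := mem_allCarlitzTorsion.1 hu
  set f : ℕ → KBar Fq := fun n => (carlitzT Fq ^ n) u with hf
  have hfs : ∀ n, f (n + 1) = carlitzT Fq (f n) := fun n => by
    simp only [hf, pow_succ', Module.End.mul_apply]
  have hfl : ∀ n, P.valuation l < P.valuation (f n) := fun n => by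
    induction n with
    | zero => simpa [hf] using hlt
    | succ n ih => rw [hfs]; exact ih.trans (valuation_lt_valuation_carlitzT P hl ih)
  have hmono : StrictMono fun n => P.valuation (f n) := strictMono_nat_of_lt_succ fun n => by
    rw [hfs]; exact valuation_lt_valuation_carlitzT P hl (hfl n)
  have hlead : P.valuation (M.leadingCoeff • f M.natDegree) = P.valuation (f M.natDegree) := by
    rw [Algebra.smul_def, map_mul,
      valuation_algebraMap_eq_one _ (leadingCoeff_ne_zero.2 hM), one_mul]
  have hsum : ∑ i ∈ Finset.range (M.natDegree + 1), M.coeff i • f i = 0 := by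
    rw [← h, aeval_eq_sum_range, LinearMap.sum_apply]
    rfl
  have hval := P.valuation.map_sum_eq_of_lt (s := Finset.range (M.natDegree + 1))
    (f := fun i => M.coeff i • f i) (j := M.natDegree) (by simp) (fun i hi => by
      simp only [Finset.mem_sdiff, Finset.mem_range, Finset.mem_singleton] at hi
      rw [← leadingCoeff, hlead, Algebra.smul_def, map_mul]
      exact (mul_le_of_le_one_left' (valuation_algebraMap_le_one _ _)).trans_lt
        (hmono (by omega)))
  rw [hsum, map_zero, ← leadingCoeff, hlead] at hval
  exact not_lt_zero (hval ▸ hfl M.natDegree)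

/-- If `l * w` is a torsion point then `w` is approximated by rational functions to any power of
`T⁻¹`. In the step from `n` to `n + 1` the hypothesis is applied to the torsion point
`carlitzT (l * w) = l * (T * (w - w ^ q))`: an approximation `k` of `T * (w - w ^ q)` gives one of
`w - w ^ q`, better by a factor `T⁻¹`, and inverting the Artin–Schreier map determines `w` to that
precision up to a constant. -/
theorem exists_valuation_sub_le_of_torsion {l : KBar Fq}
    (hl : l ^ (Fintype.card Fq - 1) = -T Fq) (n : ℕ) {w : KBar Fq}
    (hw : l * w ∈ allCarlitzTorsion Fq) :
    ∃ k : RatFunc Fq, P.valuation (algebraMap _ _ k) ≤ 1 ∧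
      P.valuation (w - algebraMap _ _ k) ≤ (P.valuation (T Fq))⁻¹ ^ n := by
  induction n generalizing w with
  | zero =>
    refine ⟨0, by simp, ?_⟩
    have h := valuation_le_of_mem_allCarlitzTorsion P hl hw
    rw [map_mul] at h
    simpa using (mul_le_iff_le_one_right
      ((Valuation.pos_iff _).2 (ne_zero_of_pow_eq hl))).1 h
  | succ n ih =>
    obtain ⟨k, hk1, hk⟩ := ih (by
      have h := carlitzT_mem_allCarlitzTorsion hw
      rwa [carlitzT_mul hl] at h)
    have hT0 : T Fq ≠ 0 := (_root_.map_ne_zero _).2 RatFunc.X_ne_zero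
    have hτ : (P.valuation (T Fq))⁻¹ ≤ 1 := inv_le_one_of_one_le₀ P.one_lt_valuation_T.le
    have hx : P.valuation.comap (algebraMap (RatFunc Fq) (KBar Fq)) (RatFunc.X⁻¹ * k) ≤
        (P.valuation (T Fq))⁻¹ := by
      rw [Valuation.comap_apply, map_mul, map_inv₀, map_mul, map_inv₀]
      exact mul_le_of_le_one_right' hk1
    obtain ⟨r, hr, hr1⟩ := exists_sub_pow_card_eq (F := Fq)
      (P.valuation.comap (algebraMap (RatFunc Fq) (KBar Fq))) (RatFunc.X⁻¹ * k) (n + 1)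
    -- `r` solves `r - r ^ q = T⁻¹ * k` up to a negligible error, so `y - y ^ q` is small for
    -- `y = w - r`, and `y` is close to a constant.
    set y : KBar Fq := w - algebraMap _ _ r with hy
    obtain ⟨c, hc⟩ := exists_valuation_sub_algebraMap_le (F := Fq) P.valuation y
    have hyq : y - y ^ Fintype.card Fq =
        (T Fq)⁻¹ * (T Fq * (w - w ^ Fintype.card Fq) - algebraMap _ _ k) +
          algebraMap (RatFunc Fq) (KBar Fq)
            ((RatFunc.X⁻¹ * k) ^ Fintype.card Fq ^ (n + 1)) := by
      have hF : y ^ Fintype.card Fq =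
          w ^ Fintype.card Fq - algebraMap _ _ r ^ Fintype.card Fq :=
        map_sub (FiniteField.frobeniusAlgHom Fq (KBar Fq)) _ _
      have hr' := congrArg (algebraMap (RatFunc Fq) (KBar Fq)) hr
      simp only [map_sub, map_pow, map_mul, map_inv₀] at hr' ⊢
      rw [hF, hy, mul_sub, inv_mul_cancel_left₀ hT0]
      linear_combination -hr'
    refine ⟨r + algebraMap Fq _ c, ?_, ?_⟩
    · rw [map_add, ← IsScalarTower.algebraMap_apply]
      exact (P.valuation.map_add _ _).trans
        (max_le (hr1 (hx.trans hτ)) (valuation_algebraMap_le_one _ c))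
    · rw [map_add, ← IsScalarTower.algebraMap_apply, ← sub_sub]
      refine hc.trans ?_
      rw [hyq]
      refine (P.valuation.map_add _ _).trans (max_le ?_ ?_)
      · rw [map_mul, map_inv₀, pow_succ']
        exact mul_le_mul_right hk _
      · -- The error `x ^ q ^ (n + 1)` is small enough because `n + 1 ≤ q ^ (n + 1)`.
        rw [map_pow, map_pow]
        exact (pow_le_pow_left' hx _).trans
          (pow_le_pow_right_of_le_one' hτ (Nat.lt_pow_self Fintype.one_lt_card).le)

/-! ### The field `V` and its degree -/

theorem qUnitCircle_subset {l : KBar Fq}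
    (hl : l ^ (Fintype.card Fq - 1) = -T Fq) :
    qUnitCircle P ⊆ {x | (P.embedHom l)⁻¹ * x ∈ Set.range P.completionHom} := by
  have hl0 := ne_zero_of_pow_eq hl
  refine closure_minimal ?_ (P.isClosed_range_completionHom.preimage (continuous_const_mul _))
  rintro _ ⟨u, hu, rfl⟩
  change (P.embedHom l)⁻¹ * P.embedHom u ∈ Set.range P.completionHom
  rw [← map_inv₀, ← map_mul]
  refine P.embedHom_mem_range_completionHom fun n => ?_
  obtain ⟨k, -, hk⟩ := exists_valuation_sub_le_of_torsion P hl n (w := l⁻¹ * u)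
    (by rwa [mul_inv_cancel_left₀ hl0])
  exact ⟨k, hk⟩

theorem V_eq_adjoin {l : KBar Fq}
    (hl : l ^ (Fintype.card Fq - 1) = -T Fq) :
    V P = IntermediateField.adjoin (KInfty Fq) {P.embedHom l} := by
  have hl0 := ne_zero_of_pow_eq hl
  refine le_antisymm (IntermediateField.adjoin_le_iff.2 fun x hx => ?_)
    (IntermediateField.adjoin_le_iff.2 ?_)
  · obtain ⟨a, ha⟩ := qUnitCircle_subset P hl hx
    have hx' : x = P.embedHom l * algebraMap (KInfty Fq) P.Completion a := by
      change x = P.embedHom l * P.completionHom a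
      rw [ha, mul_inv_cancel_left₀ ((_root_.map_ne_zero _).2 hl0)]
    rw [hx']
    exact mul_mem (IntermediateField.mem_adjoin_simple_self _ _)
      (IntermediateField.algebraMap_mem _ _)
  · rw [Set.singleton_subset_iff]
    exact IntermediateField.subset_adjoin _ _
      (subset_closure ⟨l, self_mem_allCarlitzTorsion hl, rfl⟩)

/-- The extension generated by `l` is totally ramified: the values of `a * l ^ i`, for `a ≠ 0` in
`KInfty`, lie in distinct cosets of the value group of `KInfty` for distinct `i < q - 1`, so a
polynomial of degree less than `q - 1` has nonzero value at `l`. -/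
theorem card_sub_one_le_natDegree {l : KBar Fq}
    (hl : l ^ (Fintype.card Fq - 1) = -T Fq) {p : (KInfty Fq)[X]} (hp : p ≠ 0)
    (h : aeval (P.embedHom l) p = 0) : Fintype.card Fq - 1 ≤ p.natDegree := by
  classical
  by_contra! hlt
  set g := P.valuation l with hg
  have hgT : g ^ (Fintype.card Fq - 1) = P.valuation (T Fq) := valuation_pow_eq P hl
  have hg1 : 1 < g := by
    refine (one_lt_pow_iff_of_nonneg zero_le (n := Fintype.card Fq - 1) (by omega)).1 ?_
    rw [hgT]
    exact P.one_lt_valuation_T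
  set f : ℕ → P.Completion := fun i => P.completionHom (p.coeff i) * P.embedHom l ^ i with hf
  have hfv : ∀ i ∈ p.support, ∃ m : ℤ,
      Valued.v (f i) = g ^ (((Fintype.card Fq - 1 : ℕ) : ℤ) * m + i) := fun i hi => by
    obtain ⟨m, hm⟩ := P.exists_valued_completionHom_eq (mem_support_iff.1 hi)
    refine ⟨m, ?_⟩
    rw [hf, map_mul, map_pow, hm, valued_embedHom, ← hgT,
      zpow_add₀ (zero_lt_one.trans hg1).ne', zpow_mul, zpow_natCast, zpow_natCast]
  have hinj : ∀ i ∈ p.support, ∀ j ∈ p.support, Valued.v (f i) = Valued.v (f j) → i = j := by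
    intro i hi j hj hij
    obtain ⟨m, hm⟩ := hfv i hi
    obtain ⟨n, hn⟩ := hfv j hj
    rw [hm, hn] at hij
    have he := zpow_right_injective₀ (zero_lt_one.trans hg1) hg1.ne' hij
    have hi' := (le_natDegree_of_mem_supp i hi).trans_lt hlt
    have hj' := (le_natDegree_of_mem_supp j hj).trans_lt hlt
    have he' := congrArg (· % ((Fintype.card Fq - 1 : ℕ) : ℤ)) he
    simp only [Int.mul_add_emod_self_left] at he'
    rw [Int.emod_eq_of_lt, Int.emod_eq_of_lt] at he' <;> omega
  obtain ⟨j, hj, hmax⟩ := Finset.exists_max_image p.support (fun i => Valued.v (f i))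
    (support_nonempty.2 hp)
  have hval := Valued.v.map_sum_eq_of_lt (s := p.support) (f := f) hj (fun i hi => by
    rw [Finset.mem_sdiff, Finset.mem_singleton] at hi
    exact lt_of_le_of_ne (hmax i hi.1) fun he => hi.2 (hinj i hi.1 j hj he))
  have hsum : ∑ i ∈ p.support, f i = 0 := by
    rw [← h, aeval_def, eval₂_eq_sum]
    rfl
  obtain ⟨m, hm⟩ := hfv j hj
  rw [hsum, map_zero, hm] at hval
  exact zpow_ne_zero _ (zero_lt_one.trans hg1).ne' hval.symm

end QUnitCircle

end

open QUnitCircle QUnitCircle.PlaceAboveInfty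

theorem mainTheorem1 (Fq : Type*) [Field Fq] [Fintype Fq]
    (P : QUnitCircle.PlaceAboveInfty Fq) :
    Module.rank (QUnitCircle.KInfty Fq) (QUnitCircle.V P) =
      ((Fintype.card Fq - 1 : ℕ) : Cardinal) := by
  obtain ⟨l, hl⟩ := exists_pow_card_sub_one_eq Fq
  have hq := Fintype.one_lt_card (α := Fq)
  set p : (KInfty Fq)[X] := X ^ (Fintype.card Fq - 1) +
    C ((WithVal.toVal (vInfty Fq) RatFunc.X : WithVal (vInfty Fq)) : KInfty Fq) with hp
  have hmonic : p.Monic := monic_X_pow_add_C _ (by omega)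
  have hroot : aeval (P.embedHom l) p = 0 := by
    have hT : algebraMap (KInfty Fq) P.Completion
        ((WithVal.toVal (vInfty Fq) RatFunc.X : WithVal (vInfty Fq)) : KInfty Fq) =
        P.embedHom (T Fq) := P.completionHom_coe RatFunc.X
    rw [hp, map_add, aeval_X_pow, aeval_C, hT, ← map_pow, hl, map_neg, neg_add_cancel]
  have hint : IsIntegral (KInfty Fq) (P.embedHom l) := ⟨p, hmonic, hroot⟩
  have hdeg : (minpoly (KInfty Fq) (P.embedHom l)).natDegree = Fintype.card Fq - 1 := by
    refine le_antisymm ?_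
      (card_sub_one_le_natDegree P hl (minpoly.ne_zero hint) (minpoly.aeval _ _))
    exact (natDegree_le_of_dvd (minpoly.dvd _ _ hroot) hmonic.ne_zero).trans
      (natDegree_X_pow_add_C).le
  have := IntermediateField.adjoin.finiteDimensional hint
  rw [V_eq_adjoin P hl, ← Module.finrank_eq_rank, IntermediateField.adjoin.finrank hint, hdeg]
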